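/- For integers $s,n\ge 1$, let $K_{c\times s}$ be the complete multipartite graph with $c$ classes of $s$ vertices each, and let $M_s(n)$ denote the set multipartite Ramsey number $M_s(C_4;K_{1,n})$, that is, the smallest positive integer $c$ such that every subgraph $H$ of $K_{c\times s}$ contains a copy of the four-cycle $C_4$, or the complement of $H$ relative to $K_{c\times s}$ contains a copy of the star $K_{1,n}$ with $n$ leaves. Let $q\ge 3$ be a prime power. Then: (1) $M_2(q^2-2)=\dfrac{q^2+q}{2}$. (2) If $q$ is even and $q\ge 8$, then for each odd integer $k$ with $3\le k\le q-3$, $M_2(q^2-k-1)=\dfrac{q^2+q-k+1}{2}$. (3) If $q$ is even, then $M_2((q-1)^2-2)=\dfrac{(q-1)^2+q-3}{2}+1$. (4) If $q$ is odd, then for each even integer $k$ with $2\le k\le 2\lceil q/4\rceil$, $M_2(q^2-k)=\dfrac{q^2+q-k}{2}+1$. -/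

import Mathlib

/-- `MultipartiteArrows c s G₁ G₂`: every (spanning) subgraph `H` of the complete multipartite graph
`K_{c × s}` (`c` classes of `s` vertices each) contains a copy of `G₁`, or the complement of `H`
relative to `K_{c × s}` contains a copy of `G₂`. Copies need not be induced. -/
def MultipartiteArrows {α β : Type*} (c s : ℕ) (G₁ : SimpleGraph α) (G₂ : SimpleGraph β) : Prop :=
  ∀ H : SimpleGraph (Fin c × Fin s), H ≤ SimpleGraph.completeEquipartiteGraph c s →
    G₁.IsContained H ∨ G₂.IsContained (SimpleGraph.completeEquipartiteGraph c s \ H)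

/-- The set multipartite Ramsey number `M_s(G₁; G₂)`: the smallest positive integer `c` such that
every subgraph of `K_{c × s}` contains `G₁` or its relative complement contains `G₂`
(with value `0` exactly when there is no such `c`). -/
noncomputable def setMultipartiteRamsey {α β : Type*} (s : ℕ) (G₁ : SimpleGraph α)
    (G₂ : SimpleGraph β) : ℕ :=
  sInf {c : ℕ | 0 < c ∧ MultipartiteArrows c s G₁ G₂}

/-- `M_s(n) = M_s(C₄; K_{1,n})`, with `C₄` the four-cycle and `K_{1,n}` the star with `n` leaves. -/
noncomputable def M (s n : ℕ) : ℕ :=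
  setMultipartiteRamsey s (SimpleGraph.cycleGraph 4) (completeBipartiteGraph (Fin 1) (Fin n))

/-! Upper bounds: if `H` is C₄-free and its relative complement has no n-star, all degrees in `H`
are at least 2(c-1)-(n-1), while C₄-freeness with minimum degree d forces d(d-1) < 2c
(`multipartiteArrows_of_le`). Lower bounds: the orthogonal polarity graph of PG(2,q) is C₄-free with
degrees q or q+1. Deleting a few points and polar lines leaves 2c vertices of large degree; these
split into non-adjacent pairs (`exists_equiv_forall_not_adj`), which serve as the classes of size 2.
-/

theorem not_cycleGraph_four_isContained {V : Type*} {H : SimpleGraph V}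
    (h : ∀ a b c d, a ≠ b → H.Adj a c → H.Adj b c → H.Adj a d → H.Adj b d → c = d) :
    ¬ (SimpleGraph.cycleGraph 4).IsContained H := by
  rintro ⟨f⟩
  have hadj : ∀ i j : Fin 4, (SimpleGraph.cycleGraph 4).Adj i j → H.Adj (f i) (f j) :=
    fun i j hij => f.toHom.map_adj hij
  have hne : ∀ i j : Fin 4, i ≠ j → f i ≠ f j := fun i j hij e => hij (f.injective e)
  refine hne 1 3 (by decide) (h (f 0) (f 2) (f 1) (f 3) (hne _ _ (by decide)) ?_ ?_ ?_ ?_) <;>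
    exact hadj _ _ (by decide)

theorem eq_of_not_cycleGraph_four_isContained {V : Type*} {H : SimpleGraph V}
    (h : ¬ (SimpleGraph.cycleGraph 4).IsContained H) {a b c d : V} (hab : a ≠ b)
    (hac : H.Adj a c) (hbc : H.Adj b c) (had : H.Adj a d) (hbd : H.Adj b d) : c = d := by
  by_contra hcd
  refine h ⟨⟨⟨![a, c, b, d], ?_⟩, ?_⟩⟩
  · intro i j hij
    fin_cases i <;> fin_cases j <;>
      first
        | (exfalso; revert hij; decide)
        | simp [hac, hbc, had, hbd, hac.symm, hbc.symm, had.symm, hbd.symm]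
  · intro i j hij
    have h1 := hac.ne; have h2 := hbc.ne; have h3 := had.ne; have h4 := hbd.ne
    fin_cases i <;> fin_cases j <;> simp_all

theorem star_isContained_iff {V : Type*} {G : SimpleGraph V} [G.LocallyFinite] {n : ℕ} :
    (completeBipartiteGraph (Fin 1) (Fin n)).IsContained G ↔ ∃ v, n ≤ G.degree v := by
  constructor
  · rintro ⟨f⟩
    refine ⟨f (Sum.inl 0), ?_⟩
    have := Finset.card_le_card_of_injOn (s := (Finset.univ : Finset (Fin n)))
      (t := G.neighborFinset (f (Sum.inl 0))) (fun i => f (Sum.inr i))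
      (fun i _ => by
        simp only [SimpleGraph.coe_neighborFinset, SimpleGraph.mem_neighborSet]
        exact f.toHom.map_adj (by simp))
      (fun i _ j _ hij => Sum.inr_injective (f.injective hij))
    simpa using this
  · rintro ⟨v, hv⟩
    rw [← SimpleGraph.card_neighborFinset_eq_degree] at hv
    obtain ⟨s, hs, hc⟩ := Finset.exists_subset_card_eq hv
    have hs' : ∀ i, G.Adj v (s.equivFinOfCardEq hc |>.symm i : V) := fun i => by
      have := hs (s.equivFinOfCardEq hc |>.symm i).2
      simpa using this
    refine ⟨⟨⟨Sum.elim (fun _ => v) (fun i => (s.equivFinOfCardEq hc |>.symm i : V)), ?_⟩, ?_⟩⟩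
    · rintro (i | i) (j | j) hij
      · simp at hij
      · exact hs' j
      · exact (hs' i).symm
      · simp at hij
    · rintro (i | i) (j | j) hij
      · exact congrArg _ (Subsingleton.elim i j)
      · exact absurd hij (hs' j).ne
      · exact absurd hij.symm (hs' i).ne
      · exact congrArg _ ((s.equivFinOfCardEq hc).symm.injective (Subtype.ext hij))

/-- Restrict `H` to the first `c` classes. Hence failure at a single `c` excludes all smaller
values. -/
theorem MultipartiteArrows.mono {α β : Type*} {c c' s : ℕ} {G₁ : SimpleGraph α}
    {G₂ : SimpleGraph β} (h : MultipartiteArrows c s G₁ G₂) (hc : c ≤ c') :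
    MultipartiteArrows c' s G₁ G₂ := by
  intro H hH
  let e : Fin c × Fin s ↪ Fin c' × Fin s := (Fin.castLEEmb hc).prodMap (Function.Embedding.refl _)
  have he : ∀ a b, (e a).1 = (e b).1 ↔ a.1 = b.1 := fun a b => (Fin.castLEEmb hc).injective.eq_iff
  refine (h (H.comap e) ?_).imp (fun h₁ => h₁.trans ?_) (fun h₂ => h₂.trans ?_)
  · intro a b hab
    rw [SimpleGraph.completeEquipartiteGraph_adj]
    have := hH hab
    rw [SimpleGraph.completeEquipartiteGraph_adj] at this
    exact fun h => this ((he a b).2 h)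
  · exact ⟨⟨⟨e, fun h => h⟩, e.injective⟩⟩
  · refine ⟨⟨⟨e, fun {a b} h => ?_⟩, e.injective⟩⟩
    rw [SimpleGraph.sdiff_adj, SimpleGraph.completeEquipartiteGraph_adj] at h ⊢
    exact ⟨fun h' => h.1 ((he a b).1 h'), h.2⟩

theorem setMultipartiteRamsey_eq {α β : Type*} {c s : ℕ} {G₁ : SimpleGraph α}
    {G₂ : SimpleGraph β} (h : MultipartiteArrows (c + 1) s G₁ G₂)
    (h' : ¬ MultipartiteArrows c s G₁ G₂) : setMultipartiteRamsey s G₁ G₂ = c + 1 := by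
  refine le_antisymm (Nat.sInf_le ⟨c.succ_pos, h⟩) (le_csInf ⟨c + 1, c.succ_pos, h⟩ ?_)
  rintro b ⟨-, hb⟩
  by_contra hlt
  exact h' (hb.mono (by omega))

/-! ### Upper bound by counting -/

/-- Disjointness of the second neighbourhoods in a graph without four-cycles. -/
theorem mul_pred_lt_card_of_cycleGraph_four_free {V : Type*} [Fintype V] [Nonempty V]
    {H : SimpleGraph V} [H.LocallyFinite] (h : ¬ (SimpleGraph.cycleGraph 4).IsContained H) {d : ℕ}
    (hd : ∀ v, d ≤ H.degree v) : d * (d - 1) < Fintype.card V := by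
  classical
  obtain ⟨v⟩ := ‹Nonempty V›
  have hdisj : ((H.neighborFinset v : Finset V) : Set V).PairwiseDisjoint
      (fun u => (H.neighborFinset u).erase v) := by
    intro a ha b hb hab
    rw [Function.onFun, Finset.disjoint_left]
    intro w hwa hwb
    simp only [Finset.mem_erase, SimpleGraph.mem_neighborFinset] at hwa hwb
    simp only [SimpleGraph.coe_neighborFinset, SimpleGraph.mem_neighborSet] at ha hb
    exact hwa.1 (eq_of_not_cycleGraph_four_isContained h hab ha.symm hb.symm hwa.2 hwb.2).symm
  have hcard := Finset.card_biUnion hdisj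
  -- Strict because `v` itself is erased from every set.
  have hlt : ((H.neighborFinset v).biUnion fun u => (H.neighborFinset u).erase v).card
      < Fintype.card V := by
    rw [← Finset.card_univ]
    refine Finset.card_lt_card (Finset.ssubset_univ_iff.2 fun he => ?_)
    have := he ▸ Finset.mem_univ v
    simp at this
  have hsum : d * (d - 1) ≤ ∑ u ∈ H.neighborFinset v, ((H.neighborFinset u).erase v).card := by
    calc d * (d - 1) ≤ (H.neighborFinset v).card * (d - 1) :=
          Nat.mul_le_mul_right _ (by simpa using hd v)
      _ = ∑ u ∈ H.neighborFinset v, (d - 1) := by simp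
      _ ≤ _ := Finset.sum_le_sum fun u hu => by
          rw [Finset.card_erase_of_mem (by simpa [SimpleGraph.adj_comm] using hu),
            SimpleGraph.card_neighborFinset_eq_degree]
          exact Nat.sub_le_sub_right (hd u) 1
  omega

theorem degree_add_degree_completeEquipartiteGraph_sdiff {c s : ℕ}
    {H : SimpleGraph (Fin c × Fin s)} [H.LocallyFinite]
    [(SimpleGraph.completeEquipartiteGraph c s \ H).LocallyFinite]
    (hH : H ≤ SimpleGraph.completeEquipartiteGraph c s)
    (v : Fin c × Fin s) :
    H.degree v + (SimpleGraph.completeEquipartiteGraph c s \ H).degree v = (c - 1) * s := by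
  classical
  rw [← SimpleGraph.degree_completeEquipartiteGraph v]
  simp only [← SimpleGraph.card_neighborFinset_eq_degree]
  rw [← Finset.card_union_of_disjoint]
  · congr 1
    ext w
    have := @hH v w
    simp only [Finset.mem_union, SimpleGraph.mem_neighborFinset, SimpleGraph.sdiff_adj]
    tauto
  · rw [Finset.disjoint_left]
    simp +contextual

theorem multipartiteArrows_of_le {c n d : ℕ} (hc : 0 < c) (h : n + 1 + d ≤ 2 * c)
    (hd : 2 * c ≤ d * (d - 1)) :
    MultipartiteArrows c 2 (SimpleGraph.cycleGraph 4) (completeBipartiteGraph (Fin 1) (Fin n)) := by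
  classical
  intro H hH
  by_contra hcon
  obtain ⟨h₁, h₂⟩ := not_or.1 hcon
  rw [star_isContained_iff] at h₂
  push Not at h₂
  have : Nonempty (Fin c × Fin 2) := ⟨(⟨0, hc⟩, 0)⟩
  have := mul_pred_lt_card_of_cycleGraph_four_free h₁ (d := d) fun v => by
    have e := degree_add_degree_completeEquipartiteGraph_sdiff hH v
    have := h₂ v
    omega
  simp at this
  omega

/-! ### From a C₄-free graph to two-vertex classes -/

/-- If every degree on `T` is less than `c = |T| / 2`, then `T` splits into pairs of
non-adjacent vertices. -/
theorem exists_equiv_forall_not_adj {V : Type*} [DecidableEq V] (G : SimpleGraph V)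
    [DecidableRel G.Adj] {c : ℕ} (T : Finset V) (hT : T.card = 2 * c)
    (hdeg : ∀ v ∈ T, (T.filter (G.Adj v)).card < c) :
    ∃ f : Fin c × Fin 2 ≃ T, ∀ i, ¬ G.Adj (f (i, 0)) (f (i, 1)) := by
  classical
  let bad : (Fin c × Fin 2 ≃ T) → Finset (Fin c) := fun f =>
    Finset.univ.filter fun i => G.Adj (f (i, 0)) (f (i, 1))
  have : Nonempty (Fin c × Fin 2 ≃ T) :=
    ⟨Fintype.equivOfCardEq (by simp [hT, mul_comm])⟩
  obtain ⟨f, hf⟩ := Finite.exists_min (fun f => (bad f).card)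
  refine ⟨f, fun i hi => ?_⟩
  set u := f (i, 0) with hu
  set v := f (i, 1) with hv
  -- `f` minimises the number of adjacent pairs. If both adjacencies failed, exchanging `v` with `f
  -- (j, k)` would repair pair `i` without spoiling pair `j`.
  have key : ∀ j k, j ≠ i → G.Adj u (f (j, k)) ∨ G.Adj v (f (j, k + 1)) := by
    intro j k hji
    by_contra! hcon
    have hk : k + 1 ≠ k := by fin_cases k <;> decide
    let g := (Equiv.swap (i, 1) (j, k)).trans f
    have g1 : g (i, 1) = f (j, k) := by simp [g]
    have g2 : g (j, k) = v := by simp [g, hv]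
    have g0 : ∀ x, x ≠ (i, 1) → x ≠ (j, k) → g x = f x := fun x h h' => by
      simp [g, Equiv.swap_apply_of_ne_of_ne h h']
    have g3 : g (j, k + 1) = f (j, k + 1) := g0 _ (by simp [hji]) (by simp [hk])
    have g4 : g (i, 0) = u := g0 _ (by simp) (by simp [hji.symm])
    refine absurd (hf g) (not_le.2 (Finset.card_lt_card ?_))
    rw [Finset.ssubset_iff_of_subset]
    · exact ⟨i, by simpa [bad] using hi, by simp [bad, g1, g4, hcon.1]⟩
    · intro l hl
      simp only [bad, Finset.mem_filter, Finset.mem_univ, true_and] at hl ⊢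
      rcases eq_or_ne l i with rfl | hli
      · exact hi
      rcases eq_or_ne l j with rfl | hlj
      · exfalso
        fin_cases k
        · simp only [Fin.zero_eta, zero_add] at g2 g3 hcon
          rw [g2, g3] at hl
          exact hcon.2 hl
        · have e : (1 : Fin 2) + 1 = 0 := rfl
          simp only [Fin.mk_one, e] at g2 g3 hcon
          rw [g2, g3] at hl
          exact hcon.2 hl.symm
      · rwa [g0 _ (by simp [hli]) (by simp [hlj]), g0 _ (by simp [hli]) (by simp [hlj])] at hl
  -- `σ` swaps partners, so `key` says that the neighbours of `u` and the partners of neighbours of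
  -- `v` cover all positions but `(i, 0)`: too many for two degrees below `c`.
  let σ : Fin c × Fin 2 ≃ Fin c × Fin 2 := (Equiv.refl _).prodCongr (Equiv.addRight 1)
  let A := Finset.univ.filter fun x => G.Adj u (f x)
  let B := Finset.univ.filter fun x => G.Adj v (f (σ x))
  have hA : A.card ≤ (T.filter (G.Adj u)).card :=
    Finset.card_le_card_of_injOn (fun x => (f x : V)) (fun x hx => by simpa [A] using hx)
      (fun x _ y _ h => f.injective (Subtype.ext h))
  have hB : B.card ≤ (T.filter (G.Adj v)).card :=
    Finset.card_le_card_of_injOn (fun x => (f (σ x) : V))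
      (fun x hx => by
        have : G.Adj v (f (σ x)) := by simpa [B] using hx
        exact Finset.mem_coe.2 (Finset.mem_filter.2 ⟨(f (σ x)).2, this⟩))
      (fun x _ y _ h => σ.injective (f.injective (Subtype.ext h)))
  have hU : Finset.univ.erase (i, 0) ⊆ A ∪ B := by
    rintro ⟨j, k⟩ hjk
    simp only [A, B, σ, Finset.mem_union, Finset.mem_filter, Finset.mem_univ, true_and,
      Equiv.prodCongr_apply, Prod.map, Equiv.refl_apply, Equiv.coe_addRight]
    rcases eq_or_ne j i with rfl | hji
    · fin_cases k
      · simp at hjk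
      · exact Or.inl hi
    · exact key j k hji
  have hI : 0 < (A ∩ B).card := by
    refine Finset.card_pos.2 ⟨(i, 1), ?_⟩
    simp only [A, B, σ, Finset.mem_inter, Finset.mem_filter, Finset.mem_univ, true_and,
      Equiv.prodCongr_apply, Prod.map, Equiv.refl_apply, Equiv.coe_addRight]
    exact ⟨hi, hi.symm⟩
  have hU' := Finset.card_le_card hU
  rw [Finset.card_erase_of_mem (Finset.mem_univ _)] at hU'
  simp only [Finset.card_univ, Fintype.card_prod, Fintype.card_fin] at hU'
  have := Finset.card_union_add_card_inter A B
  have := hdeg u u.2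
  have := hdeg v v.2
  omega

/-- `hmax` supplies the pairing; `hmin` amounts to 2(c-1) - deg < n, so no vertex has `n`
non-neighbours outside its class. -/
theorem not_multipartiteArrows_of_finset {V : Type*} [DecidableEq V] (G : SimpleGraph V)
    [DecidableRel G.Adj]
    (hG : ∀ a b c d, a ≠ b → G.Adj a c → G.Adj b c → G.Adj a d → G.Adj b d → c = d)
    {c n : ℕ} (T : Finset V) (hT : T.card = 2 * c)
    (hmax : ∀ v ∈ T, (T.filter (G.Adj v)).card < c)
    (hmin : ∀ v ∈ T, 2 * c ≤ n + 1 + (T.filter (G.Adj v)).card) :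
    ¬ MultipartiteArrows c 2 (SimpleGraph.cycleGraph 4)
      (completeBipartiteGraph (Fin 1) (Fin n)) := by
  classical
  obtain ⟨f, hf⟩ := exists_equiv_forall_not_adj G T hT hmax
  have hinj : Function.Injective fun x => (f x : V) := Subtype.val_injective.comp f.injective
  let H : SimpleGraph (Fin c × Fin 2) := G.comap fun x => (f x : V)
  have hH : H ≤ SimpleGraph.completeEquipartiteGraph c 2 := by
    rintro ⟨i, k⟩ ⟨j, l⟩ hadj
    rw [SimpleGraph.completeEquipartiteGraph_adj]
    rintro rfl
    simp only [H, SimpleGraph.comap_adj] at hadj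
    fin_cases k <;> fin_cases l
    · exact hadj.ne rfl
    · exact hf _ hadj
    · exact hf _ hadj.symm
    · exact hadj.ne rfl
  intro harr
  rcases harr H hH with h | h
  · exact not_cycleGraph_four_isContained (H := H)
      (fun a b x y hab h1 h2 h3 h4 => hinj (hG _ _ _ _ (hinj.ne hab) h1 h2 h3 h4)) h
  · obtain ⟨v, hv⟩ := star_isContained_iff.1 h
    have e := degree_add_degree_completeEquipartiteGraph_sdiff hH v
    have hle : (T.filter (G.Adj (f v))).card ≤ H.degree v := by
      rw [← SimpleGraph.card_neighborFinset_eq_degree]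
      refine Finset.card_le_card_of_surjOn (fun x => (f x : V)) ?_
      intro w hw
      obtain ⟨hwT, hw⟩ := Finset.mem_filter.1 (Finset.mem_coe.1 hw)
      exact ⟨f.symm ⟨w, hwT⟩, by simpa [H] using hw, by simp⟩
    have := hmin _ (f v).2
    have hc : 0 < c := v.1.pos
    omega

/-! ### Polarity graphs of projective planes -/

open Configuration

section Polarity

variable {P : Type*} [Membership P P]

/-- The polarity graph of a point set whose lines are indexed by the points themselves. -/
def polarityGraph (hs : ∀ a b : P, a ∈ b → b ∈ a) : SimpleGraph P where
  Adj a b := a ≠ b ∧ b ∈ a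
  symm := ⟨fun _ _ h => ⟨h.1.symm, hs _ _ h.2⟩⟩
  loopless := ⟨fun _ h => h.1 rfl⟩

/-- Two distinct lines share at most one point, which is C₄-freeness. -/
theorem polarityGraph_eq_of_adj [Nondegenerate P P] (hs : ∀ a b : P, a ∈ b → b ∈ a)
    (a b c d : P) (hab : a ≠ b) (hac : (polarityGraph hs).Adj a c)
    (hbc : (polarityGraph hs).Adj b c) (had : (polarityGraph hs).Adj a d)
    (hbd : (polarityGraph hs).Adj b d) : c = d :=
  (Nondegenerate.eq_or_eq hac.2 had.2 hbc.2 hbd.2).resolve_right hab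

open Classical in
theorem card_filter_mem_line [ProjectivePlane P P] [Fintype P] (l : P) :
    (Finset.univ.filter (· ∈ l)).card = ProjectivePlane.order P P + 1 := by
  rw [← ProjectivePlane.pointCount_eq P l, Configuration.pointCount, Nat.card_eq_fintype_card,
    Fintype.card_subtype]

open Classical in
theorem card_filter_mem_inter_le_one [ProjectivePlane P P] [Fintype P] {l m : P} (h : l ≠ m) :
    (Finset.univ.filter (fun b => b ∈ l ∧ b ∈ m)).card ≤ 1 := by
  rw [Finset.card_le_one]
  intro a ha b hb
  simp only [Finset.mem_filter, Finset.mem_univ, true_and] at ha hb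
  exact (Nondegenerate.eq_or_eq ha.1 hb.1 ha.2 hb.2).resolve_right h

open Classical in
theorem card_polarityGraph_filter_le [ProjectivePlane P P] [Fintype P]
    (hs : ∀ a b : P, a ∈ b → b ∈ a) (T : Finset P) (v : P) :
    (T.filter ((polarityGraph hs).Adj v)).card ≤ ProjectivePlane.order P P + 1 := by
  rw [← card_filter_mem_line v]
  refine Finset.card_le_card fun b hb => ?_
  simpa using (Finset.mem_filter.1 hb).2.2

open Classical in
/-- A vertex `v` has at most as many missing neighbours in `T` as its line has points outside
`T \ {v}`. -/
theorem card_polarityGraph_filter_ge [ProjectivePlane P P] [Fintype P]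
    (hs : ∀ a b : P, a ∈ b → b ∈ a) {T D : Finset P} {v : P}
    (hD : ∀ b, b ∈ v → b ∉ T ∨ b = v → b ∈ D) :
    ProjectivePlane.order P P + 1 ≤ (T.filter ((polarityGraph hs).Adj v)).card + D.card := by
  rw [← card_filter_mem_line v]
  refine (Finset.card_le_card fun b hb => ?_).trans (Finset.card_union_le _ _)
  simp only [Finset.mem_filter, Finset.mem_univ, true_and] at hb
  rw [Finset.mem_union, Finset.mem_filter]
  by_cases hbD : b ∈ D
  · exact Or.inr hbD
  · have := mt (hD b hb) hbD
    push Not at this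
    exact Or.inl ⟨this.1, this.2.symm, hb⟩

/-- Remove a non-absolute point together with `t` points of its polar line. -/
theorem not_multipartiteArrows_of_remove_points_of_line [ProjectivePlane P P] [Fintype P]
    (hs : ∀ a b : P, a ∈ b → b ∈ a) {x : P} (hx : x ∉ x) {q : ℕ}
    (hq : ProjectivePlane.order P P = q) {t c : ℕ} (ht : t ≤ q + 1)
    (hc : 2 * c + t = q ^ 2 + q) (hqc : q + 1 < c) {n : ℕ} (hn : 2 * c = n + q) :
    ¬ MultipartiteArrows c 2 (SimpleGraph.cycleGraph 4)
      (completeBipartiteGraph (Fin 1) (Fin n)) := by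
  classical
  subst hq
  rw [← card_filter_mem_line x] at ht
  obtain ⟨A, hA, hAt⟩ := Finset.exists_subset_card_eq ht
  have hAx : ∀ a ∈ A, a ∈ x := fun a ha => by simpa using hA ha
  have hxA : x ∉ A := fun h => hx (hAx x h)
  refine not_multipartiteArrows_of_finset (polarityGraph hs) (polarityGraph_eq_of_adj hs)
    (insert x A)ᶜ ?_ ?_ ?_
  · rw [Finset.card_compl, Finset.card_insert_of_notMem hxA, ProjectivePlane.card_points P P]
    omega
  · exact fun v _ => (card_polarityGraph_filter_le hs _ v).trans_lt hqc
  · intro v hv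
    simp only [Finset.mem_compl, Finset.mem_insert, not_or] at hv
    obtain ⟨hvx, hvA⟩ := hv
    have hone := card_filter_mem_inter_le_one hvx
    -- Besides the point common to the lines `v` and `x`, only one more neighbour can be lost: `x`
    -- itself if `v ∈ x` (an absolute `v` is then that common point), otherwise `v`. So degrees stay
    -- at least q-1.
    have main : ∃ z, ∀ b, b ∈ v → b ∉ (insert x A)ᶜ ∨ b = v →
        b ∈ insert z (Finset.univ.filter (fun b => b ∈ v ∧ b ∈ x)) := by
      by_cases hmem : v ∈ x
      · refine ⟨x, fun b hb hor => ?_⟩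
        simp only [Finset.mem_compl, not_not, Finset.mem_insert, Finset.mem_filter,
          Finset.mem_univ, true_and] at hor ⊢
        rcases hor with (h | h) | rfl
        · exact Or.inl h
        · exact Or.inr ⟨hb, hAx b h⟩
        · exact Or.inr ⟨hb, hmem⟩
      · refine ⟨v, fun b hb hor => ?_⟩
        simp only [Finset.mem_compl, not_not, Finset.mem_insert, Finset.mem_filter,
          Finset.mem_univ, true_and] at hor ⊢
        rcases hor with (rfl | h) | h
        · exact absurd (hs _ _ hb) hmem
        · exact Or.inr ⟨hb, hAx b h⟩
        · exact Or.inl h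
    obtain ⟨z, hz⟩ := main
    have h1 := card_polarityGraph_filter_ge hs hz
    have h2 := Finset.card_insert_le z (Finset.univ.filter (fun b => b ∈ v ∧ b ∈ x))
    omega

/-- If the absolute points are exactly the points of a line `p`, remove `p`, another
non-absolute point, and both polar lines. -/
theorem not_multipartiteArrows_of_remove_two_lines [ProjectivePlane P P] [Fintype P]
    (hs : ∀ a b : P, a ∈ b → b ∈ a) {p : P} (hp : p ∉ p) (habs : ∀ a : P, a ∈ a ↔ a ∈ p) {q : ℕ}
    (hq : ProjectivePlane.order P P = q) {c : ℕ}
    (hc : 2 * c + q + 2 = q ^ 2) (hqc : q < c) {n : ℕ} (hn : 2 * c + 1 = n + q) :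
    ¬ MultipartiteArrows c 2 (SimpleGraph.cycleGraph 4)
      (completeBipartiteGraph (Fin 1) (Fin n)) := by
  classical
  subst hq
  set q := ProjectivePlane.order P P with hqdef
  let line : P → Finset P := fun l => Finset.univ.filter (· ∈ l)
  have hline : ∀ l, (line l).card = q + 1 := card_filter_mem_line
  have hmem : ∀ a l, a ∈ line l ↔ a ∈ l := fun a l => by simp [line]
  have hcard : Fintype.card P = q ^ 2 + q + 1 := ProjectivePlane.card_points P P
  obtain ⟨x, hx⟩ : ∃ x, x ∉ insert p (line p) := by
    by_contra! hall
    have h1 := Finset.card_le_card (fun x _ => hall x : Finset.univ ⊆ insert p (line p))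
    have h2 := Finset.card_insert_le p (line p)
    rw [Finset.card_univ, hcard] at h1
    have := hline p
    omega
  rw [Finset.mem_insert, not_or, hmem] at hx
  obtain ⟨hxp : x ≠ p, hxnp⟩ := hx
  have hxx : x ∉ x := fun h => hxnp ((habs x).1 h)
  have hpx : p ∉ x := fun h => hxnp (hs _ _ h)
  have hinter : (line p ∩ line x).card = 1 := by
    refine le_antisymm ?_ (Finset.card_pos.2 ?_)
    · rw [← Finset.filter_and]
      exact card_filter_mem_inter_le_one hxp.symm
    · obtain ⟨h1, h2⟩ := HasPoints.mkPoint_ax (P := P) hxp.symm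
      exact ⟨_, Finset.mem_inter.2 ⟨(hmem _ _).2 h1, (hmem _ _).2 h2⟩⟩
  have hunion := Finset.card_union_add_card_inter (line p) (line x)
  rw [hinter, hline, hline] at hunion
  -- The lines cover 2(q+1)-1 points and neither contains `p` or `x`.
  have hS : (insert p (insert x (line p ∪ line x))).card = 2 * q + 3 := by
    rw [Finset.card_insert_of_notMem, Finset.card_insert_of_notMem]
    · omega
    · simp [hmem, hxnp, hxx]
    · simp [hmem, hp, hpx, Ne.symm hxp]
  have hT : ∀ v, v ∈ (insert p (insert x (line p ∪ line x)))ᶜ ↔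
      v ≠ p ∧ v ≠ x ∧ v ∉ p ∧ v ∉ x := by
    intro v
    simp [hmem]
  refine not_multipartiteArrows_of_finset (polarityGraph hs) (polarityGraph_eq_of_adj hs)
    (insert p (insert x (line p ∪ line x)))ᶜ ?_ ?_ ?_
  · rw [Finset.card_compl, hS, hcard]
    omega
  · intro v hv
    obtain ⟨h1, -, -, -⟩ := (hT v).1 hv
    -- The line `v` meets the deleted line `p`, so the degree is at most q; the bound q+1 would not
    -- be below c when q = 4.
    obtain ⟨hz1, hz2⟩ := HasPoints.mkPoint_ax (P := P) h1
    refine (Nat.lt_succ_iff.1 ?_).trans_lt hqc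
    rw [Nat.succ_eq_add_one, ← hline v]
    refine Finset.card_lt_card (Finset.ssubset_iff_of_subset ?_ |>.2 ⟨_, (hmem _ _).2 hz1, ?_⟩)
    · intro b hb
      exact (hmem _ _).2 (Finset.mem_filter.1 hb).2.2
    · intro hb
      exact ((hT _).1 (Finset.mem_filter.1 hb).1).2.2.1 hz2
  · intro v hv
    obtain ⟨h1, h2, h3, h4⟩ := (hT v).1 hv
    -- As `v` is off both lines, it is not absolute and is adjacent to neither `p` nor `x`; only its
    -- intersections with the two lines are lost.
    have := card_polarityGraph_filter_ge hs
      (T := (insert p (insert x (line p ∪ line x)))ᶜ) (v := v)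
      (D := (Finset.univ.filter fun b => b ∈ v ∧ b ∈ p) ∪
        Finset.univ.filter fun b => b ∈ v ∧ b ∈ x) (by
        intro b hb hor
        simp only [Finset.mem_union, Finset.mem_filter, Finset.mem_univ, true_and]
        rcases hor with h | rfl
        · by_contra hcon
          refine h ((hT b).2 ⟨?_, ?_, ?_, ?_⟩)
          · rintro rfl
            exact h3 (hs _ _ hb)
          · rintro rfl
            exact h4 (hs _ _ hb)
          · exact fun h => hcon (Or.inl ⟨hb, h⟩)
          · exact fun h => hcon (Or.inr ⟨hb, h⟩)
        · exact absurd ((habs _).1 hb) h3)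
    have hu := Finset.card_union_le (Finset.univ.filter fun b => b ∈ v ∧ b ∈ p)
      (Finset.univ.filter fun b => b ∈ v ∧ b ∈ x)
    have := card_filter_mem_inter_le_one h1
    have := card_filter_mem_inter_le_one h2
    omega

end Polarity

/-! ### The orthogonal polarity over a finite field -/

section Field

open scoped LinearAlgebra.Projectivization
open Projectivization

variable {K : Type*} [Field K]

theorem ofField_mem_symm (a b : ℙ K (Fin 3 → K)) (h : a ∈ b) : b ∈ a :=
  orthogonal_comm.1 h

theorem ofField_order [Fintype K] [DecidableEq K] :
    ProjectivePlane.order (ℙ K (Fin 3 → K)) (ℙ K (Fin 3 → K)) = Fintype.card K := by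
  classical
  have : Fintype (ℙ K (Fin 3 → K)) := Fintype.ofFinite _
  have h1 := ProjectivePlane.card_points (ℙ K (Fin 3 → K)) (ℙ K (Fin 3 → K))
  have h2 := Projectivization.card_of_finrank K (Fin 3 → K) (n := 3) (by simp)
  rw [Nat.card_eq_fintype_card, h1, Nat.card_eq_fintype_card] at h2
  simp only [Finset.sum_range_succ, Finset.sum_range_zero] at h2
  nlinarith

theorem exists_ofField_not_mem_self : ∃ x : ℙ K (Fin 3 → K), x ∉ x :=
  ⟨mk K ![1, 0, 0] (by simp), by simp [ofField.mem_iff, orthogonal_mk]⟩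

/-- In characteristic 2, v·v = (v₀+v₁+v₂)², so the absolute points form the polar line of (1,1,1),
which is not absolute since 1+1+1 = 1. -/
theorem exists_ofField_absolute_line [CharP K 2] :
    ∃ p : ℙ K (Fin 3 → K), p ∉ p ∧ ∀ a : ℙ K (Fin 3 → K), a ∈ a ↔ a ∈ p := by
  have h2 : (2 : K) = 0 := CharTwo.two_eq_zero
  refine ⟨mk K ![1, 1, 1] (by simp), ?_, fun a => ?_⟩
  · rw [ofField.mem_iff, orthogonal_mk]
    simp only [dotProduct, Fin.sum_univ_three, Matrix.cons_val]
    rw [show (1 : K) * 1 + 1 * 1 + 1 * 1 = 2 + 1 by ring, h2, zero_add]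
    exact one_ne_zero
  · induction a with | h v hv =>
    rw [ofField.mem_iff, ofField.mem_iff, orthogonal_mk, orthogonal_mk]
    have : v ⬝ᵥ v = (v ⬝ᵥ ![1, 1, 1]) ^ 2 := by
      simp [dotProduct, Fin.sum_univ_three]
      linear_combination (-(v 0 * v 1 + v 0 * v 2 + v 1 * v 2)) * h2
    rw [this, sq_eq_zero_iff]

end Field

/-! ### The exact values -/

open scoped LinearAlgebra.Projectivization

theorem exists_field_of_isPrimePow {q : ℕ} (hq : IsPrimePow q) :
    ∃ (K : Type) (_ : Field K) (_ : Fintype K), Fintype.card K = q := by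
  obtain ⟨p, k, hp, hk, rfl⟩ := (isPrimePow_nat_iff q).1 hq
  have : Fact p.Prime := ⟨hp⟩
  have : Fintype (GaloisField p k) := Fintype.ofFinite _
  refine ⟨GaloisField p k, inferInstance, inferInstance, ?_⟩
  rw [← Nat.card_eq_fintype_card, GaloisField.card p k hk.ne']

/-- Serves (1), (2), (4) with t = 2, k+1, k. For d = q+1 the count needs 2(c+1) ≤ q²+q, that is t ≥
2; t ≤ q+1 since the `t` points lie on one line. -/
theorem M_two_eq_of_add_eq_sq {q : ℕ} (hq : IsPrimePow q) {t c n : ℕ} (ht : 2 ≤ t)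
    (htq : t ≤ q + 1) (hc : 2 * c + t = q ^ 2 + q) (hqc : q + 1 < c) (hn : n + t = q ^ 2) :
    M 2 n = c + 1 := by
  classical
  obtain ⟨K, _, _, hK⟩ := exists_field_of_isPrimePow hq
  obtain ⟨x, hx⟩ := exists_ofField_not_mem_self (K := K)
  have : Fintype (ℙ K (Fin 3 → K)) := Fintype.ofFinite _
  refine setMultipartiteRamsey_eq
    (multipartiteArrows_of_le (d := q + 1) c.succ_pos (by omega) ?_)
    (not_multipartiteArrows_of_remove_points_of_line ofField_mem_symm hx
      (ofField_order.trans hK) htq hc hqc (by omega))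
  rw [Nat.add_sub_cancel]
  nlinarith

/-- Serves (3). Here d = q and 2(c+1) = q(q-1), so the count is tight. -/
theorem M_two_eq_of_even {q : ℕ} (hq : IsPrimePow q) (heven : Even q) {c n : ℕ}
    (hc : 2 * c + q + 2 = q ^ 2) (hqc : q < c) (hn : n + 2 * q + 1 = q ^ 2) :
    M 2 n = c + 1 := by
  classical
  obtain ⟨K, _, _, hK⟩ := exists_field_of_isPrimePow hq
  have hchar : ringChar K = 2 := FiniteField.even_card_iff_char_two.2 (by
    rw [hK]; exact Nat.even_iff.1 heven)
  have : CharP K 2 := ringChar.of_eq hchar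
  obtain ⟨p, hp, habs⟩ := exists_ofField_absolute_line (K := K)
  have : Fintype (ℙ K (Fin 3 → K)) := Fintype.ofFinite _
  refine setMultipartiteRamsey_eq
    (multipartiteArrows_of_le (d := q) c.succ_pos (by omega) ?_)
    (not_multipartiteArrows_of_remove_two_lines ofField_mem_symm hp habs
      (ofField_order.trans hK) hc hqc (by omega))
  rw [Nat.mul_sub, ← sq]
  omega

theorem theoremC (q : ℕ) (hq : IsPrimePow q) (hq3 : 3 ≤ q) :
    ((M 2 (q ^ 2 - 2) : ℚ) = ((q : ℚ) ^ 2 + q) / 2) ∧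
    (Even q → 8 ≤ q → ∀ k : ℕ, Odd k → 3 ≤ k → k ≤ q - 3 →
      (M 2 (q ^ 2 - k - 1) : ℚ) = ((q : ℚ) ^ 2 + q - k + 1) / 2) ∧
    (Even q →
      (M 2 ((q - 1) ^ 2 - 2) : ℚ) = (((q : ℚ) - 1) ^ 2 + q - 3) / 2 + 1) ∧
    (Odd q → ∀ k : ℕ, Even k → 2 ≤ k → k ≤ 2 * ⌈(q : ℚ) / 4⌉₊ →
      (M 2 (q ^ 2 - k) : ℚ) = ((q : ℚ) ^ 2 + q - k) / 2 + 1) := by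
  have hsq : 3 * q ≤ q ^ 2 := by nlinarith
  refine ⟨?_, fun heven hq8 k hk hk3 hkq => ?_, fun heven => ?_, fun _ k hk hk2 hkq => ?_⟩
  · obtain ⟨m, hm⟩ := Nat.even_mul_succ_self q
    have hm' : q ^ 2 + q = m + m := by rw [← hm]; ring
    rw [M_two_eq_of_add_eq_sq hq (t := 2) (c := m - 1) le_rfl (by omega) (by omega)
      (by have : q = 3 ∨ 4 * q ≤ q ^ 2 := by
            rcases hq3.eq_or_lt with h | h
            · exact Or.inl h.symm
            · exact Or.inr (by nlinarith)
          rcases this with rfl | h <;> omega) (by omega)]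
    have : ((m - 1 + 1 : ℕ) : ℚ) = m := by congr 1; omega
    have h2 : (q : ℚ) ^ 2 + q = m + m := by exact_mod_cast hm'
    rw [this, h2]
    ring
  · obtain ⟨m, hm⟩ := Nat.even_mul_succ_self q
    obtain ⟨j, rfl⟩ := hk
    have hm' : q ^ 2 + q = m + m := by rw [← hm]; ring
    rw [M_two_eq_of_add_eq_sq hq (t := 2 * j + 2) (c := m - j - 1) (by omega) (by omega)
      (by omega) (by have : 8 * q ≤ q ^ 2 := by nlinarith
                     omega) (by omega)]
    have hj : j + 1 ≤ m := by omega
    have : m - j - 1 + 1 = m - j := by omega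
    have h2 : (q : ℚ) ^ 2 + q = m + m := by exact_mod_cast hm'
    rw [this, Nat.cast_sub (by omega), h2]
    push_cast
    ring
  · obtain ⟨m, rfl⟩ := heven
    have h4 : 4 ≤ m + m := by omega
    have hq4 : 4 * (m + m) ≤ (m + m) ^ 2 := by nlinarith
    have hmm : (m + m) ^ 2 = 2 * (2 * m ^ 2) := by ring
    have hn : (m + m - 1) ^ 2 + 2 * (m + m) = (m + m) ^ 2 + 1 := by
      obtain ⟨r, hr⟩ : ∃ r, m + m = r + 1 := ⟨m + m - 1, by omega⟩
      rw [hr, Nat.add_sub_cancel]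
      ring
    rw [M_two_eq_of_even hq ⟨m, rfl⟩ (c := 2 * m ^ 2 - m - 1) (by omega) (by omega) (by omega)]
    have : 2 * m ^ 2 - m - 1 + 1 = 2 * m ^ 2 - m := by omega
    rw [this, Nat.cast_sub (by omega)]
    push_cast
    ring
  · obtain ⟨m, hm⟩ := Nat.even_mul_succ_self q
    obtain ⟨j, rfl⟩ := hk
    have hm' : q ^ 2 + q = m + m := by rw [← hm]; ring
    -- From ⌈q/4⌉ < q/4 + 1; it yields k ≤ q+1.
    have hceil : 2 * (j + j) < q + 4 := by
      have h1 := Nat.ceil_lt_add_one (a := (q : ℚ) / 4) (by positivity)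
      have h2 : ((j + j : ℕ) : ℚ) ≤ ((2 * ⌈(q : ℚ) / 4⌉₊ : ℕ) : ℚ) := by exact_mod_cast hkq
      push_cast at h2
      have : (2 * ((j : ℚ) + j)) < q + 4 := by linarith
      exact_mod_cast this
    rw [M_two_eq_of_add_eq_sq hq (t := j + j) (c := m - j) (by omega) (by omega) (by omega)
      (by have : q = 3 ∨ 4 * q ≤ q ^ 2 := by
            rcases hq3.eq_or_lt with h | h
            · exact Or.inl h.symm
            · exact Or.inr (by nlinarith)
          rcases this with rfl | h <;> omega) (by omega)]
    have h2 : (q : ℚ) ^ 2 + q = m + m := by exact_mod_cast hm'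
    rw [Nat.cast_add, Nat.cast_sub (by omega), h2]
    push_cast
    ring
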